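/- For $r\ge 1$ and $q\ge 1$ let $B_q^{(r)}=K_r+qK_1$ be the generalized book, that is, the graph consisting of a complete graph $K_r$ together with $q$ further pairwise non-adjacent vertices, each joined to every vertex of the $K_r$. For graphs $H_1,H_2$, the Ramsey number $r(H_1,H_2)$ is the least $n$ such that for every graph $G$ of order $n$ either $G$ contains a (not necessarily induced) copy of $H_1$ or the complement $\overline{G}$ contains a copy of $H_2$. A connected graph $H$ is called $k$-good if $r(K_k,H)=(k-1)(|V(H)|-1)+1$. **Theorem.** For all fixed integers $p\ge 2$ and $r\ge 2$ there is $q_0=q_0(p,r)$ such that for all $q\ge q_0$, $$r\bigl(K_{p+1},B_q^{(r)}\bigr)=p(q+r-1)+1 .$$ In other words, $B_q^{(r)}$ is $(p+1)$-good for all sufficiently large $q$. -/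

import Mathlib

open scoped SimpleGraph

/-- The join `G + H` of two vertex-disjoint graphs: disjoint copies of `G` and `H`, with every
vertex of `G` adjacent to every vertex of `H`. -/
def graphJoin {V W : Type*} (G : SimpleGraph V) (H : SimpleGraph W) : SimpleGraph (V ⊕ W) :=
  (G ⊕g H) ⊔ completeBipartiteGraph V W

/-- The generalized book `B_q^{(r)} = K_r + q K_1`: the join of a complete graph on `r` vertices
(the base) and `q` independent vertices (the pages). -/
def generalizedBook (r q : ℕ) : SimpleGraph (Fin r ⊕ Fin q) :=
  graphJoin (⊤ : SimpleGraph (Fin r)) (⊥ : SimpleGraph (Fin q))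

/-- The Ramsey number `r(H₁, H₂)`: the least `n` such that for every graph `G` of order `n` either
`G` contains `H₁` or the complement of `G` contains `H₂` (as a not necessarily induced
subgraph). -/
noncomputable def ramseyNumber {V W : Type*} (H₁ : SimpleGraph V) (H₂ : SimpleGraph W) : ℕ :=
  sInf {n : ℕ | ∀ G : SimpleGraph (Fin n), H₁ ⊑ G ∨ H₂ ⊑ Gᶜ}

/-- A connected graph `H` is `p`-good if `r(K_p, H) = (p - 1)(|V(H)| - 1) + 1`. -/
def IsGood (p : ℕ) {V : Type*} [Fintype V] (H : SimpleGraph V) : Prop :=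
  H.Connected ∧
    ramseyNumber (⊤ : SimpleGraph (Fin p)) H = (p - 1) * (Fintype.card V - 1) + 1

/-!
Lower bound: on at most `p * (q + r - 1)` vertices the balanced complete `p`-partite graph has no
`K_{p+1}`, and the components of its complement are cliques too small to hold the connected book.

Upper bound: let `G` be `K_{p+1}`-free on `N = p * (q + r - 1) + 1` vertices. Suppose first that
`G` contains a complete `p`-partite graph with parts of size `r`. No vertex has a neighbour in
every part, since this would complete a `K_{p+1}`; for the same reason the parts are independent.
Hence every vertex is a common non-neighbour of some part, and by pigeonhole some part has at least
`q + r` common non-neighbours, so it is the base of a book in the complement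
(`generalizedBook_isContained_compl_of_parts`).

In general, let `t_j` be the density of `j`-cliques (`cliqueDensity`), with `t_0 = 1` and
`t_{p+1} = 0`. For some `j ≤ p` the density `t_j` is bounded below while `t_{j+1}` is as small as
desired compared with this bound. By the blow-up inequality `expect_pow_le_expect_blowup`, a
positive proportion of the `j`-tuples of `r`-tuples of vertices span complete `j`-partite graphs.
As there are few `(j+1)`-cliques, averaging produces one with independent parts such that at most
`ε N` vertices have a neighbour in every part (`exists_multipartite_of_cliqueDensity`). If `j = p`,
then the argument above applies; if `j < p`, then some part has at least
`(1 - ε) N / (p - 1) ≥ q + r` common non-neighbours, which is again enough. The lemma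
`generalizedBook_isContained_compl_of_cliqueDensity` runs this as an induction on `p - j`.
-/

section
open Finset Function
open scoped BigOperators

/-! ### Averages over tuples -/

/-- Choosing a uniformly random tuple and then keeping some of its coordinates yields a uniformly
random tuple. -/
lemma expect_comp_injective {α β V : Type*} [Fintype α] [Fintype β] [DecidableEq α]
    [DecidableEq β] [Fintype V] [Nonempty V] {f : α → β} (hf : Injective f)
    (g : (α → V) → ℝ) : 𝔼 x : β → V, g (x ∘ f) = 𝔼 y : α → V, g y := by
  classical
  let e : (α ⊕ ((Set.range f)ᶜ : Set β)) ≃ β :=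
    ((Equiv.ofInjective f hf).sumCongr (Equiv.refl _)).trans (Equiv.Set.sumCompl (Set.range f))
  have he : ∀ a, e (Sum.inl a) = f a := fun a => by simp [e]
  let E : (β → V) ≃ (α → V) × (((Set.range f)ᶜ : Set β) → V) :=
    (Equiv.arrowCongr e.symm (Equiv.refl V)).trans (Equiv.sumArrowEquivProdArrow _ _ _)
  have hE : ∀ x, (E x).1 = x ∘ f := fun x => by
    funext a
    simp [E, Equiv.sumArrowEquivProdArrow, he]
  rw [Fintype.expect_equiv E (fun x => g (x ∘ f)) (fun z => g z.1) (fun x => by rw [hE]),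
    ← univ_product_univ, expect_product]
  simp

/-- The form of `expect_comp_injective` for doubly indexed tuples. -/
lemma expect_curry_comp_injective {α V : Type*} {j r : ℕ} [Fintype α] [DecidableEq α] [Fintype V]
    [Nonempty V] {f : α → Fin j × Fin r} (hf : Injective f) (g : (α → V) → ℝ) :
    𝔼 x : Fin j → Fin r → V, g (fun k => x (f k).1 (f k).2) = 𝔼 y : α → V, g y := by
  rw [← expect_comp_injective hf g]
  exact Fintype.expect_equiv (Equiv.curry _ _ _).symm _ _ fun x => rfl

lemma pow_expect_le_expect_pow {ι : Type*} [Fintype ι] [Nonempty ι] (f : ι → ℝ)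
    (hf : ∀ i, 0 ≤ f i) (n : ℕ) : (𝔼 i, f i) ^ n ≤ 𝔼 i, f i ^ n := by
  have h := Real.pow_arith_mean_le_arith_mean_pow univ (fun _ : ι => (Fintype.card ι : ℝ)⁻¹) f
    (fun _ _ => by positivity) (by simp) (fun i _ => hf i) n
  simpa [← mul_sum, Fintype.expect_eq_sum_div_card, div_eq_inv_mul] using h

lemma expect_fin_cons {V : Type*} [Fintype V] {j : ℕ} (g : (Fin (j + 1) → V) → ℝ) :
    𝔼 x, g x = 𝔼 v : V, 𝔼 y : Fin j → V, g (Fin.cons v y) := by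
  rw [← expect_product' univ univ (fun (v : V) (y : Fin j → V) => g (Fin.cons v y)),
    univ_product_univ]
  exact (Fintype.expect_equiv (Fin.consEquiv fun _ => V) _ _ fun x => rfl).symm

/-- Blow-up inequality: replacing each of the `j` arguments of `f` by `r` copies and multiplying
over all choices of copies costs no more than the power `r ^ j` of the mean. It follows from the
power mean inequality, one coordinate at a time. -/
lemma expect_pow_le_expect_blowup {V : Type*} [Fintype V] [Nonempty V] (r j : ℕ)
    (f : (Fin j → V) → ℝ) (hf : ∀ y, 0 ≤ f y) :
    (𝔼 y, f y) ^ r ^ j ≤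
      𝔼 x : Fin j → Fin r → V, ∏ σ : Fin j → Fin r, f (fun i => x i (σ i)) := by
  induction j with
  | zero =>
    have h : ∀ y, f y = f Fin.elim0 := fun y => by congr; exact Subsingleton.elim _ _
    simp [h]
  | succ j ih =>
    have key : ∀ (v : Fin r → V) (x : Fin j → Fin r → V),
        ∏ σ : Fin (j + 1) → Fin r,
            f (fun i => (Fin.cons v x : Fin (j + 1) → Fin r → V) i (σ i)) =
          ∏ σ : Fin j → Fin r, ∏ a, f (Fin.cons (v a) fun i => x i (σ i)) := by
      intro v x
      rw [← (Fin.consEquiv fun _ => Fin r).prod_comp, Fintype.prod_prod_type, Finset.prod_comm]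
      refine prod_congr rfl fun σ _ => prod_congr rfl fun a _ => ?_
      congr 1
      funext i
      refine Fin.cases ?_ (fun i => ?_) i <;> simp [Fin.consEquiv]
    rw [expect_fin_cons (V := Fin r → V)]
    simp only [key]
    calc (𝔼 y, f y) ^ r ^ (j + 1)
        = ((𝔼 y : Fin j → V, 𝔼 v : V, f (Fin.cons v y)) ^ r) ^ r ^ j := by
          rw [expect_fin_cons, expect_comm, ← pow_mul, pow_succ']
      _ ≤ (𝔼 y : Fin j → V, (𝔼 v : V, f (Fin.cons v y)) ^ r) ^ r ^ j := by
          have h0 : ∀ y : Fin j → V, 0 ≤ 𝔼 v : V, f (Fin.cons v y) :=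
            fun y => expect_nonneg fun v _ => hf _
          exact pow_le_pow_left₀ (pow_nonneg (expect_nonneg fun y _ => h0 y) _)
            (pow_expect_le_expect_pow _ h0 _) _
      _ = (𝔼 v : Fin r → V, 𝔼 y : Fin j → V, ∏ a, f (Fin.cons (v a) y)) ^ r ^ j := by
          rw [expect_comm]
          simp only [expect_pow, Fintype.piFinset_univ]
      _ ≤ 𝔼 v : Fin r → V, (𝔼 y : Fin j → V, ∏ a, f (Fin.cons (v a) y)) ^ r ^ j :=
          pow_expect_le_expect_pow _
            (fun v => expect_nonneg fun y _ => prod_nonneg fun a _ => hf _) _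
      _ ≤ _ := expect_le_expect fun v _ => ih (fun y => ∏ a, f (Fin.cons (v a) y))
          fun y => prod_nonneg fun a _ => hf _

/-! ### Clique densities and complete multipartite subgraphs -/

open Classical in
/-- The density of ordered `j`-cliques: the probability that `j` vertices chosen independently
and uniformly at random are pairwise adjacent. -/
noncomputable def cliqueDensity {V : Type*} [Fintype V] (G : SimpleGraph V) (j : ℕ) : ℝ :=
  𝔼 y : Fin j → V, if Pairwise fun i k => G.Adj (y i) (y k) then 1 else 0

lemma pairwise_adj_cons {V : Type*} {G : SimpleGraph V} {j : ℕ} {u : V} {y : Fin j → V}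
    (hy : Pairwise fun i k => G.Adj (y i) (y k)) (hu : ∀ i, G.Adj u (y i)) :
    Pairwise fun i k => G.Adj ((Fin.cons u y : Fin (j + 1) → V) i)
      ((Fin.cons u y : Fin (j + 1) → V) k) := by
  intro i k
  refine Fin.cases ?_ (fun i => ?_) i <;> refine Fin.cases ?_ (fun k => ?_) k
  · simp
  · simp [hu]
  · simpa using (hu i).symm
  · intro h
    simpa using hy (fun h' => h (by rw [h']))

lemma top_isContained_of_pairwise {V : Type*} {G : SimpleGraph V} {j : ℕ} {y : Fin j → V}
    (hy : Pairwise fun i k => G.Adj (y i) (y k)) : (⊤ : SimpleGraph (Fin j)) ⊑ G := by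
  refine ⟨⟨⟨y, fun {i k} hik => hy hik⟩, fun i k hik => ?_⟩⟩
  by_contra hne
  exact (hy hne).ne hik

lemma cliqueDensity_eq_zero {V : Type*} [Fintype V] {G : SimpleGraph V} {j : ℕ}
    (h : ¬ (⊤ : SimpleGraph (Fin j)) ⊑ G) : cliqueDensity G j = 0 := by
  exact expect_eq_zero fun y _ => if_neg fun hy => h (top_isContained_of_pairwise hy)

lemma cliqueDensity_zero {V : Type*} [Fintype V] [Nonempty V] (G : SimpleGraph V) :
    cliqueDensity G 0 = 1 := by
  unfold cliqueDensity
  simp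

open Classical in
/-- Two fixed distinct coordinates of a random tuple coincide with probability `1 / |V|`. -/
lemma expect_coord_eq {V : Type*} [Fintype V] [Nonempty V] {j r : ℕ} (i : Fin j) {a b : Fin r}
    (hab : a ≠ b) : 𝔼 x : Fin j → Fin r → V, (if x i a = x i b then (1 : ℝ) else 0) =
      1 / Fintype.card V := by
  have hinj : Injective (![(i, a), (i, b)] : Fin 2 → Fin j × Fin r) := by
    intro k l
    fin_cases k <;> fin_cases l <;> simp [hab, hab.symm]
  have h : 𝔼 x : Fin j → Fin r → V, (if x i a = x i b then (1 : ℝ) else 0) =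
      𝔼 y : Fin 2 → V, (if y 0 = y 1 then (1 : ℝ) else 0) :=
    expect_curry_comp_injective (V := V) hinj (fun y => if y 0 = y 1 then (1 : ℝ) else 0)
  refine h.trans ((Fintype.expect_equiv (finTwoArrowEquiv V) _
    (fun z : V × V => if z.1 = z.2 then (1 : ℝ) else 0) (fun y => rfl)).trans ?_)
  rw [← univ_product_univ, expect_product]
  simp

open Classical in
/-- If all transversals of a random blow-up are cliques, an edge inside a part gives a clique on
one more vertex; this happens with small probability. -/
lemma expect_adj_in_part_le {V : Type*} [Fintype V] [Nonempty V] (G : SimpleGraph V) {j r : ℕ}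
    (i : Fin j) {a b : Fin r} (hab : a ≠ b) :
    𝔼 x : Fin j → Fin r → V, (if (∀ σ : Fin j → Fin r, Pairwise fun k l =>
      G.Adj (x k (σ k)) (x l (σ l))) ∧ G.Adj (x i a) (x i b) then (1 : ℝ) else 0) ≤
      cliqueDensity G (j + 1) := by
  have hinj : Injective (Fin.cons (i, a) fun k => (k, b) : Fin (j + 1) → Fin j × Fin r) := by
    rw [Fin.cons_injective_iff]
    constructor
    · rintro ⟨k, hk⟩
      exact hab (Prod.ext_iff.1 hk).2.symm
    · intro k l h
      exact (Prod.ext_iff.1 h).1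
  rw [cliqueDensity, ← expect_curry_comp_injective (V := V) hinj]
  refine expect_le_expect fun x _ => ?_
  split_ifs with h h'
  · exact le_rfl
  · refine absurd ?_ h'
    have hc : (fun k => x ((Fin.cons (i, a) fun k => (k, b) : Fin (j + 1) → Fin j × Fin r) k).1
        ((Fin.cons (i, a) fun k => (k, b) : Fin (j + 1) → Fin j × Fin r) k).2) =
        (Fin.cons (x i a) fun k => x k b : Fin (j + 1) → V) := by
      funext k
      refine Fin.cases ?_ (fun k => ?_) k <;> simp
    simp only [funext_iff] at hc
    simp only [hc]
    refine pairwise_adj_cons (h.1 fun _ => b) fun k => ?_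
    -- The vertices `x i a` and `x k b` lie on a common transversal when `k ≠ i`.
    by_cases hk : k = i
    · subst hk; exact h.2
    · simpa [hk] using h.1 (update (fun _ => b) i a) (Ne.symm hk)
  · exact zero_le_one
  · exact le_rfl

open Classical in
/-- A random vertex together with a transversal of a random blow-up is a uniformly random
tuple. -/
lemma expect_cons_transversal {V : Type*} [Fintype V] [Nonempty V] (G : SimpleGraph V)
    {j r : ℕ} (σ : Fin j → Fin r) : (𝔼 u : V, 𝔼 x : Fin j → Fin r → V,
      if Pairwise fun k l => G.Adj ((Fin.cons u fun i => x i (σ i) : Fin (j + 1) → V) k)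
        ((Fin.cons u fun i => x i (σ i) : Fin (j + 1) → V) l) then (1 : ℝ) else 0) =
      cliqueDensity G (j + 1) := by
  rw [cliqueDensity, expect_fin_cons]
  refine expect_congr rfl fun u _ => ?_
  have hinj : Injective fun i : Fin j => (i, σ i) := fun i k h => (Prod.ext_iff.1 h).1
  exact expect_curry_comp_injective (V := V) hinj (fun y : Fin j → V =>
    if Pairwise fun k l => G.Adj ((Fin.cons u y : Fin (j + 1) → V) k)
      ((Fin.cons u y : Fin (j + 1) → V) l) then (1 : ℝ) else 0)

open Classical in
/-- If `G` has many `j`-cliques and few `(j + 1)`-cliques, then it contains an induced complete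
`j`-partite graph with parts of size `r` such that few vertices have a neighbour in every part. -/
lemma exists_multipartite_of_cliqueDensity (j r : ℕ) {δ ε : ℝ} (hδ : 0 < δ) (hε : 0 < ε) :
    ∃ η : ℝ, 0 < η ∧ ∃ N₀ : ℕ, ∀ {V : Type} [Fintype V] (G : SimpleGraph V),
      N₀ ≤ Fintype.card V → δ ≤ cliqueDensity G j → cliqueDensity G (j + 1) ≤ η →
      ∃ x : Fin j → Fin r → V, (∀ i, Injective (x i)) ∧ (∀ i a b, ¬ G.Adj (x i a) (x i b)) ∧
        (∀ i k, i ≠ k → ∀ a b, G.Adj (x i a) (x k b)) ∧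
        (#{u : V | ∀ i, ∃ a, G.Adj u (x i a)} : ℝ) ≤ ε * Fintype.card V := by
  set D : ℝ := δ ^ r ^ j with hD
  have hD0 : 0 < D := pow_pos hδ _
  set C : ℝ := j * (r * r) with hC
  have hC0 : 0 ≤ C := by positivity
  set M : ℝ := C + r ^ j / ε with hM
  have hM0 : 0 ≤ M := by positivity
  obtain ⟨N₀, hN₀⟩ := exists_nat_gt (2 * (C + 1) / D)
  -- At least a proportion `D` of the tuples have only cliques as transversals; the choice of `η`
  -- and `N₀` gives `C / |V| + M * η < D`, so the tuples that fail cannot be all of these.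
  refine ⟨D / (2 * (M + 1)), by positivity, N₀, fun {V} _ G hN hj hj1 => ?_⟩
  have hNR : 2 * (C + 1) / D < Fintype.card V := hN₀.trans_le (by exact_mod_cast hN)
  have hNpos : (0 : ℝ) < Fintype.card V := lt_of_le_of_lt (by positivity) hNR
  have : Nonempty V := Fintype.card_pos_iff.1 (by exact_mod_cast hNpos)
  by_contra hcon
  set t := cliqueDensity G (j + 1) with ht
  have ht0 : 0 ≤ t := expect_nonneg fun y _ => by positivity
  let T : (Fin j → Fin r → V) → Prop := fun x => ∀ σ : Fin j → Fin r, Pairwise fun k l =>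
    G.Adj (x k (σ k)) (x l (σ l))
  -- `T`: all transversals are cliques. The error terms count coincidences within a part, edges
  -- within a part, and vertices (as a proportion) with a neighbour in every part.
  let B₁ : (Fin j → Fin r → V) → ℝ := fun x => ∑ i : Fin j, ∑ a : Fin r, ∑ b : Fin r,
    if a ≠ b then (if x i a = x i b then (1 : ℝ) else 0) else 0
  let B₂ : (Fin j → Fin r → V) → ℝ := fun x => ∑ i : Fin j, ∑ a : Fin r, ∑ b : Fin r,
    if a ≠ b then (if T x ∧ G.Adj (x i a) (x i b) then (1 : ℝ) else 0) else 0
  let B₃ : (Fin j → Fin r → V) → ℝ := fun x => 𝔼 u : V, ∑ σ : Fin j → Fin r,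
    if Pairwise fun k l => G.Adj ((Fin.cons u fun i => x i (σ i) : Fin (j + 1) → V) k)
      ((Fin.cons u fun i => x i (σ i) : Fin (j + 1) → V) l) then (1 : ℝ) else 0
  have hB₁0 : ∀ x, 0 ≤ B₁ x := fun x => by positivity
  have hB₂0 : ∀ x, 0 ≤ B₂ x := fun x => by positivity
  have hB₃0 : ∀ x, 0 ≤ B₃ x := fun x => expect_nonneg fun y _ => by positivity
  have hD_le : D ≤ 𝔼 x : Fin j → Fin r → V, if T x then (1 : ℝ) else 0 := by
    refine (pow_le_pow_left₀ hδ.le hj _).trans ((expect_pow_le_expect_blowup r j _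
      fun y => by positivity).trans (expect_le_expect fun x _ => ?_))
    rw [prod_ite_zero]
    simp [T]
  -- Every blow-up whose transversals are cliques is counted by one of the three error terms.
  have hcover : ∀ x, (if T x then (1 : ℝ) else 0) ≤ B₁ x + B₂ x + B₃ x / ε := by
    intro x
    have h3 : 0 ≤ B₃ x / ε := div_nonneg (hB₃0 x) hε.le
    by_cases hT : T x
    swap
    · rw [if_neg hT]
      linarith [hB₁0 x, hB₂0 x]
    rw [if_pos hT]
    have hsum : ∀ (g : Fin j → Fin r → Fin r → ℝ), (∀ i a b, 0 ≤ g i a b) → ∀ i a b,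
        g i a b ≤ ∑ i, ∑ a, ∑ b, g i a b := fun g hg i a b =>
      (single_le_sum (f := fun b => g i a b) (fun b _ => hg i a b) (mem_univ b)).trans <|
      (single_le_sum (f := fun a => ∑ b, g i a b) (fun a _ => sum_nonneg fun b _ => hg i a b)
        (mem_univ a)).trans <|
      single_le_sum (f := fun i => ∑ a, ∑ b, g i a b)
        (fun i _ => sum_nonneg fun a _ => sum_nonneg fun b _ => hg i a b) (mem_univ i)
    by_cases h1 : ∀ i, Injective (x i)
    swap
    · simp only [Injective, not_forall] at h1
      obtain ⟨i, a, b, hxab, hab⟩ := h1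
      have : (if a ≠ b then (if x i a = x i b then (1 : ℝ) else 0) else 0) ≤ B₁ x :=
        hsum (fun i a b => if a ≠ b then (if x i a = x i b then (1 : ℝ) else 0) else 0)
        (fun i a b => by positivity) i a b
      rw [if_pos hab, if_pos hxab] at this
      linarith [hB₂0 x]
    by_cases h2 : ∀ i a b, ¬ G.Adj (x i a) (x i b)
    swap
    · push Not at h2
      obtain ⟨i, a, b, hxab⟩ := h2
      have hab : a ≠ b := fun h => hxab.ne (by rw [h])
      have : (if a ≠ b then (if T x ∧ G.Adj (x i a) (x i b) then (1 : ℝ) else 0) else 0) ≤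
          B₂ x := hsum (fun i a b => if a ≠ b then
        (if T x ∧ G.Adj (x i a) (x i b) then (1 : ℝ) else 0) else 0)
        (fun i a b => by positivity) i a b
      rw [if_pos hab, if_pos ⟨hT, hxab⟩] at this
      linarith [hB₁0 x]
    have hadj : ∀ i k, i ≠ k → ∀ a b, G.Adj (x i a) (x k b) := fun i k hik a b => by
      simpa [hik] using hT (update (fun _ => a) k b) hik
    have h3' : ε * Fintype.card V < #{u : V | ∀ i, ∃ a, G.Adj u (x i a)} := by
      by_contra hle
      exact hcon ⟨x, h1, h2, hadj, not_lt.1 hle⟩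
    have hge : (#{u : V | ∀ i, ∃ a, G.Adj u (x i a)} : ℝ) / Fintype.card V ≤ B₃ x := by
      rw [Finset.cast_card, sum_filter, ← Fintype.expect_eq_sum_div_card]
      refine expect_le_expect fun u _ => ?_
      split_ifs with hu
      · choose σ hσ using hu
        refine le_trans (le_of_eq ?_) (single_le_sum (f := fun σ : Fin j → Fin r =>
          if Pairwise fun k l => G.Adj ((Fin.cons u fun i => x i (σ i) : Fin (j + 1) → V) k)
            ((Fin.cons u fun i => x i (σ i) : Fin (j + 1) → V) l) then (1 : ℝ) else 0)
          (fun σ _ => by positivity) (mem_univ σ))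
        exact (if_pos (pairwise_adj_cons (hT σ) hσ)).symm
      · positivity
    have : 1 ≤ B₃ x / ε := by
      rw [le_div_iff₀ hε, one_mul]
      exact ((lt_div_iff₀ hNpos).2 h3').le.trans hge
    linarith [hB₁0 x, hB₂0 x]
  have hconst : ∀ c : ℝ, 0 ≤ c → ∀ g : Fin j → Fin r → Fin r → (Fin j → Fin r → V) → ℝ,
      (∀ i a b, a ≠ b → 𝔼 x, g i a b x ≤ c) →
      𝔼 x, (∑ i, ∑ a, ∑ b, if a ≠ b then g i a b x else 0) ≤ C * c := by
    intro c hc g hg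
    rw [expect_sum_comm]
    have : ∀ i ∈ (univ : Finset (Fin j)),
        𝔼 x, (∑ a, ∑ b, if a ≠ b then g i a b x else 0) ≤ r * (r * c) := by
      intro i _
      rw [expect_sum_comm]
      refine (sum_le_card_nsmul _ _ (r * c) fun a _ => ?_).trans (by simp)
      rw [expect_sum_comm]
      refine (sum_le_card_nsmul _ _ c fun b _ => ?_).trans (by simp)
      by_cases hab : a = b
      · simpa [hab] using hc
      · simpa [hab] using hg i a b hab
    refine (sum_le_card_nsmul _ _ _ this).trans (le_of_eq ?_)
    simp [hC]
    ring
  have hE₁ : 𝔼 x, B₁ x ≤ C * (1 / Fintype.card V) :=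
    hconst _ (by positivity) _ fun i a b hab => (expect_coord_eq i hab).le
  have hE₂ : 𝔼 x, B₂ x ≤ C * t :=
    hconst _ ht0 _ fun i a b hab => expect_adj_in_part_le G i hab
  have hE₃ : 𝔼 x, B₃ x = r ^ j * t := by
    simp only [B₃]
    rw [expect_comm]
    simp only [expect_sum_comm]
    simp [ht, expect_cons_transversal]
  have hfin : D ≤ C * (1 / Fintype.card V) + C * t + r ^ j * t / ε := by
    refine hD_le.trans ((expect_le_expect fun x _ => hcover x).trans ?_)
    rw [expect_add_distrib, expect_add_distrib, ← expect_div, hE₃]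
    linarith
  have hM' : C * t + r ^ j * t / ε = M * t := by rw [hM]; ring
  have h4 : C * (1 / Fintype.card V) < D / 2 := by
    rw [mul_one_div, div_lt_iff₀ hNpos]
    rw [div_lt_iff₀ hD0] at hNR
    linarith
  have h5 : M * t ≤ D / 2 := by
    rw [le_div_iff₀ (by positivity)] at hj1
    nlinarith
  linarith

/-! ### Books in the complement -/

lemma generalizedBook_adj_inl_inl {r q : ℕ} {a b : Fin r} :
    (generalizedBook r q).Adj (Sum.inl a) (Sum.inl b) ↔ a ≠ b := by
  simp [generalizedBook, graphJoin]

lemma generalizedBook_adj_inl_inr {r q : ℕ} {a : Fin r} {b : Fin q} :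
    (generalizedBook r q).Adj (Sum.inl a) (Sum.inr b) := by
  simp [generalizedBook, graphJoin]

lemma generalizedBook_not_adj_inr_inr {r q : ℕ} {a b : Fin q} :
    ¬ (generalizedBook r q).Adj (Sum.inr a) (Sum.inr b) := by
  simp [generalizedBook, graphJoin]

lemma generalizedBook_adj_base {r q : ℕ} (a : Fin r) {v : Fin r ⊕ Fin q} (hv : v ≠ Sum.inl a) :
    (generalizedBook r q).Adj (Sum.inl a) v := by
  rcases v with b | b
  · exact generalizedBook_adj_inl_inl.2 fun h => hv (by rw [h])
  · exact generalizedBook_adj_inl_inr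

lemma generalizedBook_connected {r : ℕ} (hr : 1 ≤ r) (q : ℕ) :
    (generalizedBook r q).Connected := by
  rw [SimpleGraph.connected_iff_exists_forall_reachable]
  refine ⟨Sum.inl ⟨0, hr⟩, fun v => ?_⟩
  by_cases hv : v = Sum.inl ⟨0, hr⟩
  · rw [hv]
  · exact (generalizedBook_adj_base _ hv).reachable

/-- An independent set of size `r` with `q + r` common non-neighbours is the base of a book in the
complement; the base itself may be among these non-neighbours. -/
lemma generalizedBook_isContained_compl {V : Type*} {G : SimpleGraph V} {r q : ℕ} {a : Fin r → V}
    (ha : Injective a) (hind : ∀ i k, ¬ G.Adj (a i) (a k)) {S : Finset V}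
    (hS : ∀ u ∈ S, ∀ i, ¬ G.Adj u (a i)) (hcard : q + r ≤ #S) :
    generalizedBook r q ⊑ Gᶜ := by
  classical
  have hq : q ≤ #(S \ univ.image a) := by
    have h1 := le_card_sdiff (univ.image a) S
    have h2 : #(univ.image a) ≤ r := card_image_le.trans (by simp)
    omega
  obtain ⟨T, hTS, hT⟩ := exists_subset_card_eq hq
  let b : Fin q → V := fun i => (T.equivFinOfCardEq hT).symm i
  have hb : Injective b := Subtype.val_injective.comp (Equiv.injective _)
  have hbT : ∀ i, b i ∈ S \ univ.image a := fun i => hTS (Subtype.coe_prop _)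
  have hne : ∀ i k, a i ≠ b k := fun i k h =>
    (mem_sdiff.1 (hbT k)).2 (mem_image.2 ⟨i, mem_univ _, h⟩)
  have hnadj : ∀ i k, ¬ G.Adj (b k) (a i) := fun i k => hS _ (mem_sdiff.1 (hbT k)).1 i
  refine ⟨⟨⟨Sum.elim a b, ?_⟩, ha.sumElim hb hne⟩⟩
  rintro (i | i) (k | k) h
  · exact (G.compl_adj _ _).2 ⟨fun h' => generalizedBook_adj_inl_inl.1 h (ha h'), hind i k⟩
  · exact (G.compl_adj _ _).2 ⟨hne i k, fun h' => hnadj i k h'.symm⟩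
  · exact (G.compl_adj _ _).2 ⟨(hne k i).symm, hnadj k i⟩
  · exact absurd h generalizedBook_not_adj_inr_inr

open Classical in
/-- Every vertex that misses some part entirely is a common non-neighbour of that part, so by the
pigeonhole principle one of the parts is the base of a large book. -/
lemma generalizedBook_isContained_compl_of_parts {V : Type*} [Fintype V] {G : SimpleGraph V}
    {j r q : ℕ} {x : Fin j → Fin r → V} (hinj : ∀ i, Injective (x i))
    (hind : ∀ i a b, ¬ G.Adj (x i a) (x i b))
    (hcard : j * (q + r - 1) + #{u : V | ∀ i, ∃ a, G.Adj u (x i a)} < Fintype.card V) :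
    generalizedBook r q ⊑ Gᶜ := by
  by_contra hcon
  have hsmall : ∀ i, #{u : V | ∀ a, ¬ G.Adj u (x i a)} ≤ q + r - 1 := fun i => by
    by_contra hlt
    exact hcon (generalizedBook_isContained_compl (hinj i) (hind i)
      (S := {u : V | ∀ a, ¬ G.Adj u (x i a)}) (fun u hu => (mem_filter.1 hu).2) (by omega))
  have hcover : (univ : Finset V) ⊆
      (univ.biUnion fun i => ({u : V | ∀ a, ¬ G.Adj u (x i a)} : Finset V)) ∪
        ({u : V | ∀ i, ∃ a, G.Adj u (x i a)} : Finset V) := by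
    intro u _
    by_cases hu : ∀ i, ∃ a, G.Adj u (x i a)
    · exact mem_union_right _ (by simpa using hu)
    · push Not at hu
      exact mem_union_left _ (by simpa using hu)
  have h1 := (card_le_card hcover).trans (card_union_le _ _)
  have h2 := card_biUnion_le_card_mul univ (fun i => ({u : V | ∀ a, ¬ G.Adj u (x i a)} : Finset V))
    (q + r - 1) fun i _ => hsmall i
  rw [card_univ] at h1
  simp only [card_univ, Fintype.card_fin] at h2
  omega

/-! ### The upper bound -/

open Classical in
/-- If no book exists, each clique density that is bounded below forces the next one to be bounded
below as well, by a constant that does not depend on `q`; at `j = p` the clique-freeness stops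
this. -/
lemma generalizedBook_isContained_compl_of_cliqueDensity {p r : ℕ} (hp : 1 ≤ p) (hr : 1 ≤ r)
    (d : ℕ) : ∀ j, j + d = p → ∀ δ : ℝ, 0 < δ → ∃ q₀ : ℕ, ∀ q, q₀ ≤ q →
      ∀ G : SimpleGraph (Fin (p * (q + r - 1) + 1)), ¬ (⊤ : SimpleGraph (Fin (p + 1))) ⊑ G →
        δ ≤ cliqueDensity G j → generalizedBook r q ⊑ Gᶜ := by
  have hbig : ∀ q, q ≤ p * (q + r - 1) + 1 := fun q => by
    have : 1 * (q + r - 1) ≤ p * (q + r - 1) := Nat.mul_le_mul_right _ hp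
    omega
  induction d with
  | zero =>
    intro j hjp δ hδ
    obtain rfl : j = p := hjp
    obtain ⟨η, hη, N₀, h⟩ := exists_multipartite_of_cliqueDensity j r hδ one_pos
    refine ⟨N₀, fun q hq G hG hj => ?_⟩
    obtain ⟨x, hinj, hind, hadj, -⟩ := h G (by simpa using hq.trans (hbig q)) hj
      (by rw [cliqueDensity_eq_zero hG]; exact hη.le)
    refine generalizedBook_isContained_compl_of_parts hinj hind ?_
    -- A vertex with a neighbour in every part would complete a clique on `j + 1` vertices.
    have h0 : #{u | ∀ i, ∃ a, G.Adj u (x i a)} = 0 := by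
      rw [card_eq_zero, filter_eq_empty_iff]
      intro u _ hu
      choose σ hσ using hu
      exact hG (top_isContained_of_pairwise
        (pairwise_adj_cons (fun i k hik => hadj i k hik (σ i) (σ k)) hσ))
    rw [h0]
    simp
  | succ d ih =>
    intro j hjd δ hδ
    -- With this `ε` at most `q + r - 1` vertices have a neighbour in every part.
    have hε : (0 : ℝ) < 1 / (p + 1) := by positivity
    obtain ⟨η, hη, N₀, h⟩ := exists_multipartite_of_cliqueDensity j r hδ hε
    obtain ⟨q₁, hq₁⟩ := ih (j + 1) (by omega) η hη
    refine ⟨max N₀ q₁, fun q hq G hG hj => ?_⟩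
    rcases le_total η (cliqueDensity G (j + 1)) with hj1 | hj1
    · exact hq₁ q ((le_max_right _ _).trans hq) G hG hj1
    obtain ⟨x, hinj, hind, -, hbad⟩ := h G
      (by simpa using ((le_max_left _ _).trans hq).trans (hbig q)) hj hj1
    refine generalizedBook_isContained_compl_of_parts hinj hind ?_
    rw [Fintype.card_fin] at hbad ⊢
    rw [one_div_mul_eq_div, le_div_iff₀ (by positivity)] at hbad
    have hbad' : #{u | ∀ i, ∃ a, G.Adj u (x i a)} * (p + 1) ≤ p * (q + r - 1) + 1 := by
      exact_mod_cast hbad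
    have hle : #{u | ∀ i, ∃ a, G.Adj u (x i a)} ≤ q + r - 1 := by
      by_contra hlt
      have := Nat.mul_le_mul_right (p + 1) (not_le.1 hlt)
      nlinarith
    have : (j + 1) * (q + r - 1) ≤ p * (q + r - 1) := Nat.mul_le_mul_right _ (by omega)
    rw [add_mul] at this
    omega

/-! ### The lower bound -/

/-- The graph joining numbers in different residue classes modulo `p`: a balanced complete
`p`-partite graph, whose complement has no book larger than a residue class. -/
lemma exists_graph_no_clique_no_book {p r q m : ℕ} (hp : 1 ≤ p) (hr : 1 ≤ r)
    (hm : m ≤ p * (q + r - 1)) : ∃ G : SimpleGraph (Fin m),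
      ¬ (⊤ : SimpleGraph (Fin (p + 1))) ⊑ G ∧ ¬ generalizedBook r q ⊑ Gᶜ := by
  refine ⟨SimpleGraph.mk (fun u v => (u : ℕ) % p ≠ v % p) ⟨fun u v h => h.symm⟩ ⟨fun u h => h rfl⟩,
    ?_, ?_⟩
  · rintro ⟨f⟩
    obtain ⟨i, k, hik, h⟩ := Fintype.exists_ne_map_eq_of_card_lt
      (fun i : Fin (p + 1) => (⟨(f i : ℕ) % p, Nat.mod_lt _ hp⟩ : Fin p)) (by simp)
    have hadj := f.toHom.map_adj (show (⊤ : SimpleGraph (Fin (p + 1))).Adj i k from hik)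
    exact hadj (Fin.ext_iff.1 h)
  · rintro ⟨f⟩
    have hmod : ∀ v, (f v : ℕ) % p = (f (Sum.inl ⟨0, hr⟩) : ℕ) % p := by
      intro v
      by_cases hv : v = Sum.inl ⟨0, hr⟩
      · rw [hv]
      · have hadj := f.toHom.map_adj (generalizedBook_adj_base ⟨0, hr⟩ hv)
        exact (not_not.1 hadj.2).symm
    -- Within a residue class the quotient by `p` determines the number.
    have hdiv : ∀ v, (f v : ℕ) / p < q + r - 1 := fun v =>
      Nat.div_lt_of_lt_mul ((f v).2.trans_le hm)
    obtain ⟨u, v, huv, h⟩ := Fintype.exists_ne_map_eq_of_card_lt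
      (fun v => (⟨(f v : ℕ) / p, hdiv v⟩ : Fin (q + r - 1)))
      (by simp only [Fintype.card_fin, Fintype.card_sum]; omega)
    refine huv (f.injective (Fin.ext ?_))
    change (f u : ℕ) = f v
    rw [← Nat.div_add_mod (f u : ℕ) p, ← Nat.div_add_mod (f v : ℕ) p, hmod u, hmod v,
      show (f u : ℕ) / p = f v / p from Fin.ext_iff.1 h]

end

/-- The value in the first conjunct is positive, so it is an attained minimum: in `ℕ` the infimum
of the empty set is `0`. -/
theorem mainTheorem1 (p r : ℕ) (hp : 2 ≤ p) (hr : 2 ≤ r) :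
    ∃ q₀ : ℕ, ∀ q : ℕ, q₀ ≤ q →
      ramseyNumber (⊤ : SimpleGraph (Fin (p + 1))) (generalizedBook r q) = p * (q + r - 1) + 1 ∧
      IsGood (p + 1) (generalizedBook r q) := by
  have hp1 : 1 ≤ p := by omega
  have hr1 : 1 ≤ r := by omega
  obtain ⟨q₀, hq₀⟩ := generalizedBook_isContained_compl_of_cliqueDensity hp1 hr1 p 0 (zero_add p)
    1 one_pos
  refine ⟨q₀, fun q hq => ?_⟩
  have hram : ramseyNumber (⊤ : SimpleGraph (Fin (p + 1))) (generalizedBook r q) =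
      p * (q + r - 1) + 1 := by
    have hmem : ∀ G : SimpleGraph (Fin (p * (q + r - 1) + 1)),
        (⊤ : SimpleGraph (Fin (p + 1))) ⊑ G ∨ generalizedBook r q ⊑ Gᶜ := fun G =>
      or_iff_not_imp_left.2 fun hG => hq₀ q hq G hG (cliqueDensity_zero G).ge
    refine le_antisymm (Nat.sInf_le hmem) (le_csInf ⟨_, hmem⟩ fun m hm => ?_)
    by_contra hlt
    obtain ⟨G, h1, h2⟩ := exists_graph_no_clique_no_book (q := q) (m := m) hp1 hr1 (by omega)
    exact (hm G).elim h1 h2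
  refine ⟨hram, generalizedBook_connected hr1 q, hram.trans ?_⟩
  simp [add_comm q r]
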